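/- Proposition 2.4. All manifolds are smooth, real and finite dimensional. Let $H$ be a Lie group with Lie algebra $\mathfrak h$, and let $G\subset H$ be a (possibly only immersed) Lie subgroup with Lie algebra $\mathfrak g\subset\mathfrak h$. Let $\mathfrak h=V\oplus\mathfrak g$ be a reductive decomposition, i.e. a direct sum of vector spaces with $[\mathfrak g,V]\subset V$ and $\mathrm{Ad}(G)V\subset V$, and assume that the adjoint representation $\mathrm{Ad}:G\to GL(V)$ is faithful. Let $p:P\to M$ be a principal $G$-bundle with principal right action $r^g(u)=r_u(g)=u.g$, fundamental vector fields $\zeta_X(u)=T_e(r_u)X$ for $X\in\mathfrak g$, and vertical bundle $VP=\ker Tp$. We use the following notions. * A principal Cartan connection on $p:P\to M$ is a smooth 1-form $\kappa:TP\to\mathfrak h$ such that (a) $\kappa_u:T_uP\to\mathfrak h$ is a linear isomorphism for every $u\in P$; (b) the vector fields $\zeta^\kappa_X(u)=\kappa_u^{-1}(X)$ satisfy $[\zeta^\kappa_X,\zeta^\kappa_Y]=\zeta^\kappa_{[X,Y]}$ for all $X\in\mathfrak h$, $Y\in\mathfrak g$; (c) $\kappa(\zeta_X(u))=X$ for all $X\in\mathfrak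 g$, $u\in P$; (d) $\kappa\circ T(r^g)=\mathrm{Ad}(g^{-1})\circ\kappa$ for all $g\in G$. * A principal connection form on $P$ is a smooth 1-form $\omega:TP\to\mathfrak g$ with $\omega(\zeta_X(u))=X$ for all $X\in\mathfrak g$, $u\in P$, and $\omega\circ T(r^g)=\mathrm{Ad}(g^{-1})\circ\omega$ for all $g\in G$. * A displacement form is a smooth 1-form $\theta:TP\to V$ with $\theta\circ T(r^g)=\mathrm{Ad}(g^{-1})|_V\circ\theta$ for all $g\in G$ and $\ker\theta=VP$. The pair $(p:P\to M,\theta)$ is a $G$-structure (for $G$ regarded as a linear Lie group through its smooth faithful representation in $V$) if $\theta$ is a displacement form and $\dim M=\dim V$. Then: 1. If $\kappa:TP\to\mathfrak h=V\oplus\mathfrak g$ is a principal Cartan connection on $p:P\to M$, with components $\theta=\mathrm{pr}_V\circ\kappa$ and $\omega=\mathrm{pr}_{\mathfrak g}\circ\kappa$, then $\theta$ is a displacement form and $\omega$ is a principal connection form, and $(p:P\to M,\theta)$ is a $G$-structure (in particular $\dim M=\dim V$) with connection form $\omega$. 2. Conversely, if $(p:P\to M,\theta)$ is a $G$-structure and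 $\omega$ is a principal connection form on $P$, then $\kappa=\theta+\omega$ is a principal Cartan connection on $p:P\to M$. -/

import Mathlib

open scoped Manifold ContDiff

noncomputable section

namespace CartanConn

/-! Manifolds are smooth, real, finite dimensional and without boundary: they are charted on a
finite dimensional normed space `E` through the model `𝓘(ℝ, E)`.  A tangent space `T_x M` is a copy
of `E` that is determined by the point `x`; below, tangent spaces at provably equal points (such as
`g * 1 * g⁻¹` and `1`) are identified by a type ascription. -/

section LieGroups

variable {EG : Type*} [NormedAddCommGroup EG] [NormedSpace ℝ EG]
  {G : Type*} [TopologicalSpace G] [ChartedSpace EG G] [Group G]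
  {EH : Type*} [NormedAddCommGroup EH] [NormedSpace ℝ EH]
  {H : Type*} [TopologicalSpace H] [ChartedSpace EH H] [Group H]

/-- The Lie algebra `T_1 G` of `G`, with the bracket of left invariant vector fields. -/
abbrev Lie (EG : Type*) [NormedAddCommGroup EG] [NormedSpace ℝ EG]
    (G : Type*) [TopologicalSpace G] [ChartedSpace EG G] [Group G] : Type _ :=
  GroupLieAlgebra 𝓘(ℝ, EG) G

/-- The adjoint action `Ad g = T_1 (x ↦ g x g⁻¹)` of `G` on its Lie algebra. -/
def Ad (g : G) : Lie EG G →ₗ[ℝ] Lie EG G :=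
  (mfderiv 𝓘(ℝ, EG) 𝓘(ℝ, EG) (fun x : G => g * x * g⁻¹) 1).toLinearMap

theorem Ad_one_apply (v : Lie EG G) : Ad (1 : G) v = v := by
  have key : ∀ f : G → G, f = id → mfderiv 𝓘(ℝ, EG) 𝓘(ℝ, EG) f 1 v = (v : EG) := by
    rintro f rfl
    rw [mfderiv_id]
    rfl
  exact key _ (by ext x; simp)

theorem Ad_mul_apply [LieGroup 𝓘(ℝ, EG) ∞ G] (g k : G) (v : Lie EG G) :
    Ad (g * k) v = Ad g (Ad k v) := by
  have hd : ∀ (a x : G), MDifferentiableAt 𝓘(ℝ, EG) 𝓘(ℝ, EG) (fun x : G => a * x * a⁻¹) x := by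
    intro a x
    have : ContMDiff 𝓘(ℝ, EG) 𝓘(ℝ, EG) ∞ (fun x : G => a * x * a⁻¹) :=
      (contMDiff_const.mul contMDiff_id).mul contMDiff_const
    exact this.contMDiffAt.mdifferentiableAt (by simp)
  have key : ∀ (f : G → G) (y : G), f = (fun x : G => g * x * g⁻¹) ∘ (fun x : G => k * x * k⁻¹) →
      y = k * 1 * k⁻¹ → mfderiv 𝓘(ℝ, EG) 𝓘(ℝ, EG) f 1 v
        = (mfderiv 𝓘(ℝ, EG) 𝓘(ℝ, EG) (fun x : G => g * x * g⁻¹) y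
          (mfderiv 𝓘(ℝ, EG) 𝓘(ℝ, EG) (fun x : G => k * x * k⁻¹) 1 v : EG) : EG) := by
    rintro f y rfl rfl
    rw [mfderiv_comp (1 : G) (hd g _) (hd k _)]
    rfl
  exact key _ 1 (by ext x; simp [mul_assoc]) (by simp)

/-- The differential at the identity of a homomorphism of Lie groups. -/
def dHom (EG : Type*) [NormedAddCommGroup EG] [NormedSpace ℝ EG]
    {G : Type*} [TopologicalSpace G] [ChartedSpace EG G] [Group G]
    (EH : Type*) [NormedAddCommGroup EH] [NormedSpace ℝ EH]
    {H : Type*} [TopologicalSpace H] [ChartedSpace EH H] [Group H]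
    (ι : G →* H) : Lie EG G →ₗ[ℝ] Lie EH H :=
  (mfderiv 𝓘(ℝ, EG) 𝓘(ℝ, EH) ι 1).toLinearMap

/-- `ι` exhibits `G` as an (immersed) Lie subgroup of `H`. -/
structure IsLieSubgroup (EG : Type*) [NormedAddCommGroup EG] [NormedSpace ℝ EG]
    {G : Type*} [TopologicalSpace G] [ChartedSpace EG G] [Group G]
    (EH : Type*) [NormedAddCommGroup EH] [NormedSpace ℝ EH]
    {H : Type*} [TopologicalSpace H] [ChartedSpace EH H] [Group H]
    (ι : G →* H) : Prop where
  contMDiff : ContMDiff 𝓘(ℝ, EG) 𝓘(ℝ, EH) ∞ ι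
  injective : Function.Injective ι
  injective_dHom : Function.Injective (dHom EG EH ι)

/-- `𝔤`, as a subspace of `𝔥`. -/
def subAlg (EG : Type*) [NormedAddCommGroup EG] [NormedSpace ℝ EG]
    {G : Type*} [TopologicalSpace G] [ChartedSpace EG G] [Group G]
    (EH : Type*) [NormedAddCommGroup EH] [NormedSpace ℝ EH]
    {H : Type*} [TopologicalSpace H] [ChartedSpace EH H] [Group H]
    (ι : G →* H) : Submodule ℝ (Lie EH H) :=
  LinearMap.range (dHom EG EH ι)

/-- The reductive decomposition `𝔥 = V ⊕ 𝔤`, `[𝔤, V] ⊆ V`, with `V` stable under `Ad G`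
(so that there is an adjoint representation of `G` in `V`; for connected `G` this follows). -/
structure IsReductive (EG : Type*) [NormedAddCommGroup EG] [NormedSpace ℝ EG]
    {G : Type*} [TopologicalSpace G] [ChartedSpace EG G] [Group G]
    {EH : Type*} [NormedAddCommGroup EH] [NormedSpace ℝ EH]
    {H : Type*} [TopologicalSpace H] [ChartedSpace EH H] [Group H]
    (ι : G →* H) (V : Submodule ℝ (Lie EH H)) : Prop where
  isCompl : IsCompl V (subAlg EG EH ι)
  lie_mem : ∀ X ∈ subAlg EG EH ι, ∀ v ∈ V, ⁅X, v⁆ ∈ V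
  Ad_mem : ∀ g : G, ∀ v ∈ V, Ad (ι g) v ∈ V

/-- The adjoint representation of `G` in `V`. -/
def adRep [LieGroup 𝓘(ℝ, EH) ∞ H] {ι : G →* H} {V : Submodule ℝ (Lie EH H)}
    (hV : IsReductive EG ι V) : Representation ℝ G V where
  toFun g := (Ad (ι g)).restrict (hV.Ad_mem g)
  map_one' := by
    ext v
    simp [LinearMap.restrict_apply, Ad_one_apply]
  map_mul' g k := by
    ext v
    simp [LinearMap.restrict_apply, Ad_mul_apply]

/-- The projection `𝔥 = V ⊕ 𝔤 → V`. -/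
def prV {ι : G →* H} {V : Submodule ℝ (Lie EH H)} (hV : IsReductive EG ι V) :
    Lie EH H →ₗ[ℝ] V :=
  V.projectionOnto (subAlg EG EH ι) hV.isCompl

/-- The projection `𝔥 = V ⊕ 𝔤 → 𝔤`, with values in the Lie algebra of `G`. -/
def prG {ι : G →* H} {V : Submodule ℝ (Lie EH H)} (hι : IsLieSubgroup EG EH ι)
    (hV : IsReductive EG ι V) : Lie EH H →ₗ[ℝ] Lie EG G :=
  (LinearEquiv.ofInjective (dHom EG EH ι) hι.injective_dHom).symm.toLinearMap ∘ₗ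
    (subAlg EG EH ι).projectionOnto V hV.isCompl.symm

end LieGroups

section Forms

variable {EP : Type*} [NormedAddCommGroup EP] [NormedSpace ℝ EP]
  {P : Type*} [TopologicalSpace P] [ChartedSpace EP P]

/-- A (not necessarily smooth) `W`-valued 1-form on `P`. -/
abbrev Form (EP : Type*) [NormedAddCommGroup EP] [NormedSpace ℝ EP]
    (P : Type*) [TopologicalSpace P] [ChartedSpace EP P]
    (W : Type*) [AddCommGroup W] [Module ℝ W] : Type _ :=
  ∀ u : P, TangentSpace 𝓘(ℝ, EP) u →ₗ[ℝ] W

/-- Smoothness of a 1-form with values in a finite dimensional vector space `W`: all its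
components, as functions on the tangent bundle `TP`, are smooth. -/
def IsSmoothForm [IsManifold 𝓘(ℝ, EP) ∞ P] {W : Type*} [AddCommGroup W] [Module ℝ W]
    (α : Form EP P W) : Prop :=
  ∀ ℓ : Module.Dual ℝ W, ContMDiff 𝓘(ℝ, EP).tangent 𝓘(ℝ) ∞
    (fun ξ : TangentBundle 𝓘(ℝ, EP) P => ℓ (α ξ.proj ξ.snd))

/-- The parallel vector field `ζ_X(u) = (κ_u)⁻¹ X` of a non-degenerate form `κ`. -/
def parallelField {W : Type*} [AddCommGroup W] [Module ℝ W] (κ : Form EP P W)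
    (hκ : ∀ u, Function.Bijective (κ u)) (X : W) (u : P) : TangentSpace 𝓘(ℝ, EP) u :=
  (LinearEquiv.ofBijective (κ u) (hκ u)).symm X

/-- A Cartan connection of type `𝔥/𝔤` on the manifold `P`, for the Lie algebra `𝔥` of `H`. -/
structure IsCartanConnection [IsManifold 𝓘(ℝ, EP) ∞ P]
    {EH : Type*} [NormedAddCommGroup EH] [NormedSpace ℝ EH]
    {H : Type*} [TopologicalSpace H] [ChartedSpace EH H] [Group H]
    (𝔤 : Submodule ℝ (Lie EH H)) (κ : Form EP P (Lie EH H)) : Prop where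
  smooth : IsSmoothForm κ
  bijective : ∀ u, Function.Bijective (κ u)
  bracket : ∀ X : Lie EH H, ∀ Y ∈ 𝔤, ∀ u : P,
    VectorField.mlieBracket 𝓘(ℝ, EP) (parallelField κ bijective X) (parallelField κ bijective Y) u
      = parallelField κ bijective ⁅X, Y⁆ u

end Forms

section Bundles

variable {EG : Type*} [NormedAddCommGroup EG] [NormedSpace ℝ EG]
  {G : Type*} [TopologicalSpace G] [ChartedSpace EG G] [Group G]
  {EP : Type*} [NormedAddCommGroup EP] [NormedSpace ℝ EP]
  {P : Type*} [TopologicalSpace P] [ChartedSpace EP P] [MulAction Gᵐᵒᵖ P]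
  {EM : Type*} [NormedAddCommGroup EM] [NormedSpace ℝ EM]
  {M : Type*} [TopologicalSpace M] [ChartedSpace EM M]

/-- The principal right action `r^g : u ↦ u.g`; a right action of `G` is an action of `Gᵐᵒᵖ`. -/
def rt (g : G) (u : P) : P := MulOpposite.op g • u

/-- `p : P → M` with the right action of `G` on `P` is a smooth principal `G`-bundle: it is locally
isomorphic, `G`-equivariantly and over the base, to `U × G → U`. -/
structure IsPrincipalBundle (EG : Type*) [NormedAddCommGroup EG] [NormedSpace ℝ EG]
    (G : Type*) [TopologicalSpace G] [ChartedSpace EG G] [Group G]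
    (EP : Type*) [NormedAddCommGroup EP] [NormedSpace ℝ EP]
    {P : Type*} [TopologicalSpace P] [ChartedSpace EP P] [MulAction Gᵐᵒᵖ P]
    (EM : Type*) [NormedAddCommGroup EM] [NormedSpace ℝ EM]
    {M : Type*} [TopologicalSpace M] [ChartedSpace EM M]
    (p : P → M) : Prop where
  contMDiff_action : ContMDiff (𝓘(ℝ, EP).prod 𝓘(ℝ, EG)) 𝓘(ℝ, EP) ∞
    (fun q : P × G => rt q.2 q.1)
  contMDiff_proj : ContMDiff 𝓘(ℝ, EP) 𝓘(ℝ, EM) ∞ p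
  proj_rt : ∀ (u : P) (g : G), p (rt g u) = p u
  exists_trivialization : ∀ x : M, ∃ e : Bundle.Trivialization G p, x ∈ e.baseSet ∧
    ContMDiffOn 𝓘(ℝ, EP) (𝓘(ℝ, EM).prod 𝓘(ℝ, EG)) ∞ e e.source ∧
    ContMDiffOn (𝓘(ℝ, EM).prod 𝓘(ℝ, EG)) 𝓘(ℝ, EP) ∞ e.toOpenPartialHomeomorph.symm e.target ∧
    ∀ u ∈ e.source, ∀ g : G, e (rt g u) = ((e u).1, (e u).2 * g)

/-- The vertical space `V_u P = ker T_u p`. -/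
def vertical (EP : Type*) [NormedAddCommGroup EP] [NormedSpace ℝ EP]
    {P : Type*} [TopologicalSpace P] [ChartedSpace EP P]
    (EM : Type*) [NormedAddCommGroup EM] [NormedSpace ℝ EM]
    {M : Type*} [TopologicalSpace M] [ChartedSpace EM M]
    (p : P → M) (u : P) : Submodule ℝ (TangentSpace 𝓘(ℝ, EP) u) :=
  LinearMap.ker (mfderiv 𝓘(ℝ, EP) 𝓘(ℝ, EM) p u).toLinearMap

/-- The tangent map `T_u (r^g)` of the principal right action. -/
def tangentRt (g : G) (u : P) :
    TangentSpace 𝓘(ℝ, EP) u →L[ℝ] TangentSpace 𝓘(ℝ, EP) (rt g u) :=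
  mfderiv 𝓘(ℝ, EP) 𝓘(ℝ, EP) (fun v : P => rt g v) u

/-- The fundamental vector field `ζ_X(u) = T_e (r_u) X`, where `r_u g = u.g`. -/
def fundField (X : Lie EG G) (u : P) : TangentSpace 𝓘(ℝ, EP) u :=
  mfderiv 𝓘(ℝ, EG) 𝓘(ℝ, EP) (fun g : G => rt g u) 1 X

/-- A principal Cartan connection: a Cartan connection of type `𝔥/𝔤` on `P` that is `G`-equivariant
and extends the vertical parallelism `ζ_X(u) ↦ X`, the inverse of `T_e (r_u) : 𝔤 → V_u P`. -/
structure IsPrincipalCartanConnection [IsManifold 𝓘(ℝ, EP) ∞ P]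
    {EH : Type*} [NormedAddCommGroup EH] [NormedSpace ℝ EH]
    {H : Type*} [TopologicalSpace H] [ChartedSpace EH H] [Group H]
    (EG : Type*) [NormedAddCommGroup EG] [NormedSpace ℝ EG] [ChartedSpace EG G]
    (ι : G →* H) (κ : Form EP P (Lie EH H)) : Prop
    extends IsCartanConnection (subAlg EG EH ι) κ where
  vertical_eq : ∀ (u : P) (X : Lie EG G), κ u (fundField X u) = dHom EG EH ι X
  equivariant : ∀ (g : G) (u : P) (ξ : TangentSpace 𝓘(ℝ, EP) u),
    κ (rt g u) (tangentRt g u ξ) = Ad (ι g⁻¹) (κ u ξ)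

/-- A principal connection form. -/
structure IsConnectionForm [IsManifold 𝓘(ℝ, EP) ∞ P] (om : Form EP P (Lie EG G)) : Prop where
  smooth : IsSmoothForm om
  vertical_eq : ∀ (u : P) (X : Lie EG G), om u (fundField X u) = X
  equivariant : ∀ (g : G) (u : P) (ξ : TangentSpace 𝓘(ℝ, EP) u),
    om (rt g u) (tangentRt g u ξ) = Ad g⁻¹ (om u ξ)

/-- A displacement form: a `V`-valued 1-form that is `G`-equivariant and strictly horizontal. -/
structure IsDisplacementForm [IsManifold 𝓘(ℝ, EP) ∞ P]
    (EM : Type*) [NormedAddCommGroup EM] [NormedSpace ℝ EM] [ChartedSpace EM M]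
    {V : Type*} [AddCommGroup V] [Module ℝ V] (ρ : Representation ℝ G V)
    (p : P → M) (θ : Form EP P V) : Prop where
  smooth : IsSmoothForm θ
  equivariant : ∀ (g : G) (u : P) (ξ : TangentSpace 𝓘(ℝ, EP) u),
    θ (rt g u) (tangentRt g u ξ) = ρ g⁻¹ (θ u ξ)
  ker_eq : ∀ u : P, LinearMap.ker (θ u) = vertical EP EM p u

/-- `(p : P → M, θ)` is a `G`-structure, where `G` is a linear Lie group through the faithful
smooth representation `ρ` in `V`, and `dim M = dim V`. -/
structure IsGStructure [IsManifold 𝓘(ℝ, EP) ∞ P]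
    (EG : Type*) [NormedAddCommGroup EG] [NormedSpace ℝ EG] [ChartedSpace EG G]
    (EM : Type*) [NormedAddCommGroup EM] [NormedSpace ℝ EM] [ChartedSpace EM M]
    {V : Type*} [AddCommGroup V] [Module ℝ V] (ρ : Representation ℝ G V)
    (p : P → M) (θ : Form EP P V) : Prop where
  faithful : Function.Injective ρ
  smooth_rep : ∀ (v : V) (ℓ : Module.Dual ℝ V),
    ContMDiff 𝓘(ℝ, EG) 𝓘(ℝ) ∞ (fun g : G => ℓ (ρ g v))
  principal : IsPrincipalBundle EG G EP EM p
  dim_eq : ∀ x : M, Module.finrank ℝ (TangentSpace 𝓘(ℝ, EM) x) = Module.finrank ℝ V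
  displacement : IsDisplacementForm EM ρ p θ

end Bundles

end CartanConn

end

namespace CartanConn

open scoped Topology
open Filter

/-! Apart from the bracket condition, the statement is linear algebra in `𝔥 = V ⊕ 𝔤`. The operator
`Ad (ι g)` is block diagonal: it preserves `V` by hypothesis, and on the image of `𝔤` it is `Ad g`
by naturality of conjugation (`Ad_dHom`). So equivariance of `κ` splits into equivariance of its
components and is recovered from them. A local trivialization shows that vertical vectors are
exactly the values of fundamental fields (`mem_vertical_iff`) and that `dim P = dim M + dim G`.
Hence, for a Cartan connection, `ker θ`, the vectors that `κ` sends into `𝔤`, is vertical, and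
counting dimensions gives `dim M = dim V`. Conversely, `θ` detects horizontal directions and `ω`
vertical ones, so `θ + ω` is injective, and bijective by the same count.

The analytic content is the bracket condition for `θ + ω`. The general fact is
`mlieBracket_fundField`: if `W (u.g) = T(r^g) (a g)`, then `[W, ζ_Y](u) = -da(Y)`. It is proved in
charts from the symmetry of second derivatives, without flows. It is used twice. For `H` acting on
itself by right translations and `W` left invariant, it gives `[X, Y] = -d(h ↦ Ad h X)(Y)`. For `P`
and `W = ζ^κ_X`, equivariance gives `a g = κ_u⁻¹ (Ad (ι g) X)`, so the bracket is `κ_u⁻¹` of the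
same derivative, that is, `κ_u⁻¹ [X, Y]`. -/

/-! ### Calculus in normed spaces: bracket with an infinitesimal generator. -/

theorem fderiv_apply_prodMk_zero {E F E' : Type*} [NormedAddCommGroup E] [NormedSpace ℝ E]
    [NormedAddCommGroup F] [NormedSpace ℝ F] [NormedAddCommGroup E'] [NormedSpace ℝ E']
    {ρ : E × F → E'} {x : E} {f : F} (hρ : DifferentiableAt ℝ ρ (x, f)) (b : E) :
    fderiv ℝ ρ (x, f) (b, 0) = fderiv ℝ (fun x' => ρ (x', f)) x b := by
  have h := hρ.hasFDerivAt.comp x (hasFDerivAt_prodMk_left (𝕜 := ℝ) x f)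
  have h2 : fderiv ℝ (fun x' => ρ (x', f)) x = _ := h.fderiv
  rw [h2]; simp

theorem fderiv_apply_zero_prodMk {E F E' : Type*} [NormedAddCommGroup E] [NormedSpace ℝ E]
    [NormedAddCommGroup F] [NormedSpace ℝ F] [NormedAddCommGroup E'] [NormedSpace ℝ E']
    {ρ : E × F → E'} {x : E} {f : F} (hρ : DifferentiableAt ℝ ρ (x, f)) (b : F) :
    fderiv ℝ ρ (x, f) (0, b) = fderiv ℝ (fun f' => ρ (x, f')) f b := by
  have h := hρ.hasFDerivAt.comp f (hasFDerivAt_prodMk_right (𝕜 := ℝ) x f)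
  have h2 : fderiv ℝ (fun f' => ρ (x, f')) f = _ := h.fderiv
  rw [h2]; simp

/-- The Lie bracket of a vector field `W` that is transformed by a local action `ρ` of `F` on `E`
with the infinitesimal generator `Z` of that action. -/
theorem lieBracket_generator {E F : Type*} [NormedAddCommGroup E] [NormedSpace ℝ E]
    [NormedAddCommGroup F] [NormedSpace ℝ F] {ρ : E × F → E} {x₀ : E} {f₀ : F}
    (hρ : ContDiffAt ℝ 2 ρ (x₀, f₀)) (hid : ∀ᶠ x in 𝓝 x₀, ρ (x, f₀) = x)
    {W Z : E → E} (hW : DifferentiableAt ℝ W x₀) {Y : F}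
    (hZ : ∀ᶠ x in 𝓝 x₀, Z x = fderiv ℝ ρ (x, f₀) (0, Y))
    {B : F → E} (hB : DifferentiableAt ℝ B f₀)
    (hWB : ∀ᶠ g in 𝓝 f₀, W (ρ (x₀, g)) = fderiv ℝ ρ (x₀, g) (B g, 0)) :
    VectorField.lieBracket ℝ W Z x₀ = - fderiv ℝ B f₀ Y := by
  have hd : DifferentiableAt ℝ ρ (x₀, f₀) := hρ.differentiableAt (by simp)
  have hd2 : DifferentiableAt ℝ (fderiv ℝ ρ) (x₀, f₀) :=
    (hρ.fderiv_right (m := 1) (by norm_num)).differentiableAt (by simp)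
  have hx : ρ (x₀, f₀) = x₀ := hid.self_of_nhds
  have hleft : ∀ b, fderiv ℝ ρ (x₀, f₀) (b, 0) = b := by
    intro b
    rw [fderiv_apply_prodMk_zero hd, Filter.EventuallyEq.fderiv_eq (f := fun x => x) hid]
    simp
  have hB0 : B f₀ = W x₀ := by
    have := hWB.self_of_nhds
    rw [hx, hleft] at this
    exact this.symm
  have hZ' : fderiv ℝ Z x₀ (W x₀) = fderiv ℝ (fderiv ℝ ρ) (x₀, f₀) (W x₀, 0) (0, Y) := by
    rw [Filter.EventuallyEq.fderiv_eq hZ]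
    have h := (hd2.hasFDerivAt.comp x₀ (hasFDerivAt_prodMk_left (𝕜 := ℝ) x₀ f₀)).clm_apply
      (hasFDerivAt_const ((0, Y) : E × F) x₀)
    have h2 : fderiv ℝ (fun x => fderiv ℝ ρ (x, f₀) (0, Y)) x₀ = _ := h.fderiv
    rw [h2]; simp
  -- Differentiate `hWB` at `f₀` along `Y`: the left side gives `DW(Z)`, the right side a mixed
  -- second derivative of `ρ` plus the derivative of `B`.
  have hW' : fderiv ℝ W x₀ (Z x₀) =
      fderiv ℝ (fderiv ℝ ρ) (x₀, f₀) (0, Y) (W x₀, 0) + fderiv ℝ B f₀ Y := by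
    have h1 := (hd2.hasFDerivAt.comp f₀ (hasFDerivAt_prodMk_right (𝕜 := ℝ) x₀ f₀)).clm_apply
      (hB.hasFDerivAt.prodMk (hasFDerivAt_const (0 : F) f₀))
    have h2 : HasFDerivAt (fun g => W (ρ (x₀, g))) _ f₀ :=
      HasFDerivAt.comp f₀ (g := W) (f := fun g => ρ (x₀, g)) (by rw [hx]; exact hW.hasFDerivAt)
        (hd.hasFDerivAt.comp f₀ (hasFDerivAt_prodMk_right (𝕜 := ℝ) x₀ f₀))
    have h3 := h2.unique (h1.congr_of_eventuallyEq hWB)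
    have h4 := congrArg (fun l => l Y) h3
    have hZ0 := hZ.self_of_nhds
    simp only [ContinuousLinearMap.comp_apply, ContinuousLinearMap.inr_apply,
      add_apply, ContinuousLinearMap.flip_apply,
      ContinuousLinearMap.prod_apply, zero_apply, hleft, hB0,
      Function.comp_apply] at h4
    rw [hZ0, h4, add_comm]
  -- In `DZ(W) - DW(Z)` the two mixed second derivatives of `ρ` cancel by symmetry.
  have hsymm : IsSymmSndFDerivAt ℝ ρ (x₀, f₀) := hρ.isSymmSndFDerivAt (by simp)
  simp only [VectorField.lieBracket_eq]
  rw [hZ', hW', hsymm.eq]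
  abel

/-! ### Vector fields and differentials read in a chart. -/

section Charts

variable {E : Type*} [NormedAddCommGroup E] [NormedSpace ℝ E]
  {M : Type*} [TopologicalSpace M] [ChartedSpace E M] [IsManifold 𝓘(ℝ, E) ∞ M]

theorem mdifferentiableAt_extChartAt_of_mem {x y : M} (hy : y ∈ (extChartAt 𝓘(ℝ, E) x).source) :
    MDifferentiableAt 𝓘(ℝ, E) 𝓘(ℝ, E) (extChartAt 𝓘(ℝ, E) x) y := by
  have : IsManifold 𝓘(ℝ, E) 1 M := IsManifold.of_le (n := ∞) (by simp)
  exact mdifferentiableAt_extChartAt (by rwa [extChartAt_source] at hy)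

/-- The chart representative of a vector field. -/
theorem mpullbackWithin_extChartAt_symm (V : ∀ y : M, TangentSpace 𝓘(ℝ, E) y) {x y : M}
    (hy : y ∈ (extChartAt 𝓘(ℝ, E) x).source) :
    VectorField.mpullbackWithin 𝓘(ℝ, E) 𝓘(ℝ, E) (extChartAt 𝓘(ℝ, E) x).symm V
      (Set.range 𝓘(ℝ, E)) (extChartAt 𝓘(ℝ, E) x y) =
      (mfderiv 𝓘(ℝ, E) 𝓘(ℝ, E) (extChartAt 𝓘(ℝ, E) x) y (V y) : E) := by
  have : IsManifold 𝓘(ℝ, E) 1 M := IsManifold.of_le (n := ∞) (by simp)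
  have hz := (extChartAt 𝓘(ℝ, E) x).map_source hy
  -- The point `φ.symm (φ y)` equals `y` only propositionally, and tangent spaces depend on the
  -- point; generalizing the point and substituting avoids transport. The later `key` statements
  -- serve the same purpose.
  have key : ∀ y', y' = y → (mfderiv 𝓘(ℝ, E) 𝓘(ℝ, E) (extChartAt 𝓘(ℝ, E) x) y' (V y') : E) =
      (mfderiv 𝓘(ℝ, E) 𝓘(ℝ, E) (extChartAt 𝓘(ℝ, E) x) y (V y) : E) := by
    rintro _ rfl; rfl
  rw [← key _ ((extChartAt 𝓘(ℝ, E) x).left_inv hy), VectorField.mpullbackWithin_apply,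
    ContinuousLinearMap.inverse_eq
    (mfderivWithin_extChartAt_symm_comp_mfderiv_extChartAt hz)
    (mfderiv_extChartAt_comp_mfderivWithin_extChartAt_symm hz)]
  rfl

/-- The derivative of a map `F` from a manifold to a vector space, read in a chart. -/
theorem fderiv_comp_extChartAt_symm_apply {K : Type*} [NormedAddCommGroup K] [NormedSpace ℝ K]
    {x y : M} (hy : y ∈ (extChartAt 𝓘(ℝ, E) x).source) {F : M → K}
    (hF : MDifferentiableAt 𝓘(ℝ, E) 𝓘(ℝ, K) F y) :
    DifferentiableAt ℝ (fun z => F ((extChartAt 𝓘(ℝ, E) x).symm z)) (extChartAt 𝓘(ℝ, E) x y) ∧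
    ∀ ξ : TangentSpace 𝓘(ℝ, E) y,
    fderiv ℝ (fun z => F ((extChartAt 𝓘(ℝ, E) x).symm z)) (extChartAt 𝓘(ℝ, E) x y)
      (mfderiv 𝓘(ℝ, E) 𝓘(ℝ, E) (extChartAt 𝓘(ℝ, E) x) y ξ : E) =
      (mfderiv 𝓘(ℝ, E) 𝓘(ℝ, K) F y ξ : K) := by
  have : IsManifold 𝓘(ℝ, E) 1 M := IsManifold.of_le (n := ∞) (by simp)
  have hz := (extChartAt 𝓘(ℝ, E) x).map_source hy
  have hs : MDifferentiableAt 𝓘(ℝ, E) 𝓘(ℝ, E) (extChartAt 𝓘(ℝ, E) x).symm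
      (extChartAt 𝓘(ℝ, E) x y) := by
    have := mdifferentiableWithinAt_extChartAt_symm (I := 𝓘(ℝ, E)) hz
    rwa [modelWithCornersSelf_coe, Set.range_id, mdifferentiableWithinAt_univ] at this
  have hd : MDifferentiableAt 𝓘(ℝ, E) 𝓘(ℝ, K) (F ∘ (extChartAt 𝓘(ℝ, E) x).symm)
      (extChartAt 𝓘(ℝ, E) x y) :=
    MDifferentiableAt.comp _ (by rwa [(extChartAt 𝓘(ℝ, E) x).left_inv hy]) hs
  refine ⟨hd.differentiableAt, fun ξ => ?_⟩
  have h1 := mfderiv_comp y hd (mdifferentiableAt_extChartAt_of_mem hy)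
  have h2 : (F ∘ (extChartAt 𝓘(ℝ, E) x).symm) ∘ (extChartAt 𝓘(ℝ, E) x) =ᶠ[𝓝 y] F := by
    filter_upwards [(isOpen_extChartAt_source x).mem_nhds hy] with w hw
    simp only [Function.comp_apply, (extChartAt 𝓘(ℝ, E) x).left_inv hw]
  rw [h2.mfderiv_eq] at h1
  have h3 := congrArg (fun l => (l ξ : K)) h1
  rw [mfderiv_eq_fderiv] at h3
  exact h3.symm

end Charts

/-! ### Brackets with fundamental fields of a right action. -/

section Action

variable {EG : Type*} [NormedAddCommGroup EG] [NormedSpace ℝ EG]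
  {G : Type*} [TopologicalSpace G] [ChartedSpace EG G] [Group G]
  {EP : Type*} [NormedAddCommGroup EP] [NormedSpace ℝ EP]
  {P : Type*} [TopologicalSpace P] [ChartedSpace EP P]
  [MulAction Gᵐᵒᵖ P]

theorem rt_one {G P : Type*} [Group G] [MulAction Gᵐᵒᵖ P] (u : P) : rt (1 : G) u = u := by simp [rt]

theorem contMDiff_rt_right
    (hact : ContMDiff (𝓘(ℝ, EP).prod 𝓘(ℝ, EG)) 𝓘(ℝ, EP) ∞ (fun q : P × G => rt q.2 q.1)) (u : P) :
    ContMDiff 𝓘(ℝ, EG) 𝓘(ℝ, EP) ∞ (fun g : G => rt g u) :=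
  hact.comp (contMDiff_const.prodMk contMDiff_id)

theorem contMDiff_rt_left
    (hact : ContMDiff (𝓘(ℝ, EP).prod 𝓘(ℝ, EG)) 𝓘(ℝ, EP) ∞ (fun q : P × G => rt q.2 q.1)) (g : G) :
    ContMDiff 𝓘(ℝ, EP) 𝓘(ℝ, EP) ∞ (fun u : P => rt g u) :=
  hact.comp (contMDiff_id.prodMk contMDiff_const)

/-- The right action read in charts. -/
noncomputable def chartAction (EG : Type*) [NormedAddCommGroup EG] [NormedSpace ℝ EG]
    (G : Type*) [TopologicalSpace G] [ChartedSpace EG G] [Group G]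
    {EP : Type*} [NormedAddCommGroup EP] [NormedSpace ℝ EP]
    {P : Type*} [TopologicalSpace P] [ChartedSpace EP P] [MulAction Gᵐᵒᵖ P]
    (u₀ : P) (q : EP × EG) : EP :=
  extChartAt 𝓘(ℝ, EP) u₀
    (rt ((extChartAt 𝓘(ℝ, EG) (1 : G)).symm q.2) ((extChartAt 𝓘(ℝ, EP) u₀).symm q.1))

variable [IsManifold 𝓘(ℝ, EG) ∞ G] [IsManifold 𝓘(ℝ, EP) ∞ P]

theorem contDiffAt_chartAction
    (hact : ContMDiff (𝓘(ℝ, EP).prod 𝓘(ℝ, EG)) 𝓘(ℝ, EP) ∞ (fun q : P × G => rt q.2 q.1))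
    (u₀ : P) :
    ContDiffAt ℝ 2 (chartAction EG G u₀)
      (extChartAt 𝓘(ℝ, EP) u₀ u₀, extChartAt 𝓘(ℝ, EG) (1 : G) 1) := by
  have h1 : ContMDiffAt 𝓘(ℝ, EP) 𝓘(ℝ, EP) ∞ (extChartAt 𝓘(ℝ, EP) u₀).symm
      (extChartAt 𝓘(ℝ, EP) u₀ u₀) :=
    (contMDiffOn_extChartAt_symm u₀).contMDiffAt (extChartAt_target_mem_nhds u₀)
  have h2 : ContMDiffAt 𝓘(ℝ, EG) 𝓘(ℝ, EG) ∞ (extChartAt 𝓘(ℝ, EG) (1 : G)).symm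
      (extChartAt 𝓘(ℝ, EG) (1 : G) 1) :=
    (contMDiffOn_extChartAt_symm (1 : G)).contMDiffAt (extChartAt_target_mem_nhds (1 : G))
  have h3 : ContMDiffAt (𝓘(ℝ, EP).prod 𝓘(ℝ, EG)) 𝓘(ℝ, EP) ∞ (chartAction EG G u₀)
      (extChartAt 𝓘(ℝ, EP) u₀ u₀, extChartAt 𝓘(ℝ, EG) (1 : G) 1) := by
    refine ContMDiffAt.comp _ (g := extChartAt 𝓘(ℝ, EP) u₀) (I' := 𝓘(ℝ, EP)) ?_
      (ContMDiffAt.comp _ (g := fun q : P × G => rt q.2 q.1) (I' := 𝓘(ℝ, EP).prod 𝓘(ℝ, EG))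
        (f := fun q : EP × EG => ((extChartAt 𝓘(ℝ, EP) u₀).symm q.1,
          (extChartAt 𝓘(ℝ, EG) (1 : G)).symm q.2)) hact.contMDiffAt (h1.prodMap' h2))
    apply contMDiffAt_extChartAt'
    simp [rt_one]
  rw [← modelWithCornersSelf_prod, chartedSpaceSelf_prod] at h3
  exact h3.contDiffAt.of_le ENat.LEInfty.out

/-- If `W (u₀.g) = T (r^g) (a g)`, then the Lie bracket of `W` with the fundamental vector field
of `Y` is minus the derivative of `a` in the direction `Y`. -/
theorem mlieBracket_fundField
    (hact : ContMDiff (𝓘(ℝ, EP).prod 𝓘(ℝ, EG)) 𝓘(ℝ, EP) ∞ (fun q : P × G => rt q.2 q.1))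
    (u₀ : P) (W : ∀ u : P, TangentSpace 𝓘(ℝ, EP) u)
    (hW : DifferentiableAt ℝ (VectorField.mpullbackWithin 𝓘(ℝ, EP) 𝓘(ℝ, EP)
      (extChartAt 𝓘(ℝ, EP) u₀).symm W (Set.range 𝓘(ℝ, EP))) (extChartAt 𝓘(ℝ, EP) u₀ u₀))
    {a : G → EP} (ha : MDifferentiableAt 𝓘(ℝ, EG) 𝓘(ℝ, EP) a 1)
    (hWa : ∀ g : G, W (rt g u₀) = tangentRt (EP := EP) g u₀ (a g)) (Y : Lie EG G) :
    VectorField.mlieBracket 𝓘(ℝ, EP) W (fundField Y) u₀ =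
      - (mfderiv 𝓘(ℝ, EG) 𝓘(ℝ, EP) a 1 Y : EP) := by
  have : IsManifold 𝓘(ℝ, EP) 1 P := IsManifold.of_le (n := ∞) (by simp)
  set φ := extChartAt 𝓘(ℝ, EP) u₀ with hφ
  set ψ := extChartAt 𝓘(ℝ, EG) (1 : G) with hψ
  have hu₀ : u₀ ∈ φ.source := mem_extChartAt_source u₀
  have h1G : (1 : G) ∈ ψ.source := mem_extChartAt_source (1 : G)
  let D : EP →L[ℝ] EP := mfderiv 𝓘(ℝ, EP) 𝓘(ℝ, EP) φ u₀
  have hDinv : D.IsInvertible := isInvertible_mfderiv_extChartAt hu₀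
  let Y' : EG := mfderiv 𝓘(ℝ, EG) 𝓘(ℝ, EG) ψ 1 Y
  -- Every `a g` is a tangent vector at the same point `u₀`, so a single linear map `D` reads the
  -- whole family in the chart.
  let B : EG → EP := fun f => D (a (ψ.symm f))
  have hC2 := contDiffAt_chartAction (EG := EG) (G := G) hact u₀
  have hdiff : ∀ᶠ q in 𝓝 (φ u₀, ψ 1), DifferentiableAt ℝ (chartAction EG G u₀) q := by
    filter_upwards [hC2.eventually (by simp)] with q hq
    exact hq.differentiableAt (by simp)
  have hDa : MDifferentiableAt 𝓘(ℝ, EG) 𝓘(ℝ, EP) (fun g => D (a g)) 1 :=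
    D.mdifferentiableAt.comp 1 ha
  obtain ⟨hB, hB'⟩ := fderiv_comp_extChartAt_symm_apply h1G hDa
  have hBY : fderiv ℝ B (ψ 1) Y' = D (mfderiv 𝓘(ℝ, EG) 𝓘(ℝ, EP) a 1 Y : EP) := by
    refine (hB' Y).trans ?_
    have := mfderiv_comp 1 (g := D) (I' := 𝓘(ℝ, EP)) D.mdifferentiableAt ha
    rw [mfderiv_eq_fderiv, ContinuousLinearMap.fderiv] at this
    exact congrArg (fun l => (l Y : EP)) this
  have hid : ∀ᶠ x in 𝓝 (φ u₀), chartAction EG G u₀ (x, ψ 1) = x := by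
    filter_upwards [extChartAt_target_mem_nhds u₀] with x hx
    simp only [chartAction, ← hφ, ← hψ, ψ.left_inv h1G, rt_one, φ.right_inv hx]
  have hZ : ∀ᶠ x in 𝓝 (φ u₀), VectorField.mpullbackWithin 𝓘(ℝ, EP) 𝓘(ℝ, EP) φ.symm
      (fundField Y) (Set.range 𝓘(ℝ, EP)) x =
      fderiv ℝ (chartAction EG G u₀) (x, ψ 1) (0, Y') := by
    have hc : Tendsto (fun x : EP => (x, ψ 1)) (𝓝 (φ u₀)) (𝓝 (φ u₀, ψ 1)) :=
      (Continuous.prodMk_left (ψ 1)).continuousAt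
    filter_upwards [extChartAt_target_mem_nhds u₀, hc.eventually hdiff] with x hx hdx
    rw [fderiv_apply_zero_prodMk hdx]
    obtain ⟨u, hu, rfl⟩ : ∃ u ∈ φ.source, φ u = x := ⟨φ.symm x, φ.map_target hx, φ.right_inv hx⟩
    rw [mpullbackWithin_extChartAt_symm _ hu]
    have key : ∀ y, y = rt (1 : G) u →
        (mfderiv 𝓘(ℝ, EP) 𝓘(ℝ, EP) φ y (fundField (P := P) Y u : EP) : EP) =
        mfderiv 𝓘(ℝ, EG) 𝓘(ℝ, EP) (fun g : G => φ (rt g u)) 1 Y := by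
      rintro y rfl
      have := mfderiv_comp (1 : G) (g := φ) (f := fun g : G => rt g u) (I' := 𝓘(ℝ, EP))
        (mdifferentiableAt_extChartAt_of_mem (by rwa [rt_one]))
        ((contMDiff_rt_right hact u).mdifferentiableAt (by simp))
      exact (congrArg (fun l => (l Y : EP)) this).symm
    refine (key u (rt_one u).symm).trans ?_
    have hF : MDifferentiableAt 𝓘(ℝ, EG) 𝓘(ℝ, EP) (fun g : G => φ (rt g u)) 1 :=
      MDifferentiableAt.comp (I' := 𝓘(ℝ, EP)) (1 : G) (g := φ) (f := fun g : G => rt g u)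
        (mdifferentiableAt_extChartAt_of_mem (by rwa [rt_one]))
        ((contMDiff_rt_right hact u).mdifferentiableAt (by simp))
    have := (fderiv_comp_extChartAt_symm_apply h1G hF).2 Y
    refine this.symm.trans ?_
    simp only [chartAction, ← hφ, φ.left_inv hu]
    rfl
  have hWB : ∀ᶠ f in 𝓝 (ψ 1), VectorField.mpullbackWithin 𝓘(ℝ, EP) 𝓘(ℝ, EP) φ.symm W
      (Set.range 𝓘(ℝ, EP)) (chartAction EG G u₀ (φ u₀, f)) =
      fderiv ℝ (chartAction EG G u₀) (φ u₀, f) (B f, 0) := by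
    have hc : Tendsto (fun f : EG => (φ u₀, f)) (𝓝 (ψ 1)) (𝓝 (φ u₀, ψ 1)) :=
      (Continuous.prodMk_right (φ u₀)).continuousAt
    have hsrc : ∀ᶠ f in 𝓝 (ψ 1), rt (ψ.symm f) u₀ ∈ φ.source := by
      have h1 : ContinuousAt (fun f => rt (ψ.symm f) u₀) (ψ 1) :=
        ContinuousAt.comp (g := fun g : G => rt g u₀)
          (contMDiff_rt_right hact u₀).continuous.continuousAt
          (continuousAt_extChartAt_symm (I := 𝓘(ℝ, EG)) (1 : G))
      refine h1.eventually ((isOpen_extChartAt_source u₀).mem_nhds ?_)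
      change rt (ψ.symm (ψ 1)) u₀ ∈ φ.source
      rwa [ψ.left_inv h1G, rt_one]
    filter_upwards [hsrc, hc.eventually hdiff] with f hf hdf
    rw [fderiv_apply_prodMk_zero hdf]
    have hF : MDifferentiableAt 𝓘(ℝ, EP) 𝓘(ℝ, EP) (fun u : P => φ (rt (ψ.symm f) u)) u₀ :=
      MDifferentiableAt.comp (I' := 𝓘(ℝ, EP)) u₀ (g := φ) (f := fun u : P => rt (ψ.symm f) u)
        (mdifferentiableAt_extChartAt_of_mem hf)
        ((contMDiff_rt_left hact _).mdifferentiableAt (by simp))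
    have h1 := (fderiv_comp_extChartAt_symm_apply hu₀ hF).2 (a (ψ.symm f))
    refine Eq.trans ?_ h1.symm
    have h2 : chartAction EG G u₀ (φ u₀, f) = φ (rt (ψ.symm f) u₀) := by
      simp only [chartAction, ← hφ, ← hψ, φ.left_inv hu₀]
    rw [h2, mpullbackWithin_extChartAt_symm _ hf, hWa]
    have := mfderiv_comp u₀ (g := φ) (f := fun u : P => rt (ψ.symm f) u) (I' := 𝓘(ℝ, EP))
        (mdifferentiableAt_extChartAt_of_mem hf)
        ((contMDiff_rt_left hact _).mdifferentiableAt (by simp))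
    exact (congrArg (fun l => (l (a (ψ.symm f)) : EP)) this).symm
  have hbr := lieBracket_generator hC2 hid hW hZ hB hWB
  -- The manifold bracket at `u₀` is `D⁻¹` of the bracket of the chart representatives, which undoes
  -- the `D` in `hBY`.
  rw [← VectorField.mlieBracketWithin_univ, VectorField.mlieBracketWithin_apply]
  simp only [Set.preimage_univ, Set.univ_inter, modelWithCornersSelf_coe, Set.range_id]
  simp only [modelWithCornersSelf_coe, Set.range_id] at hbr
  have h4 : ∀ v : EP, D.inverse (-D v) = -v := by
    intro v
    obtain ⟨e, he⟩ := hDinv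
    rw [← he]; simp
  exact (congrArg D.inverse ((congrFun VectorField.lieBracketWithin_univ _).trans
    (hbr.trans (congrArg Neg.neg hBY)))).trans (h4 _)

end Action

/-! ### The adjoint action: smoothness, derivative and naturality. -/

section Adjoint

variable {EH : Type*} [NormedAddCommGroup EH] [NormedSpace ℝ EH]
  {H : Type*} [TopologicalSpace H] [ChartedSpace EH H] [Group H] [LieGroup 𝓘(ℝ, EH) ∞ H]

/-- The orbit map `h ↦ Ad h v`, with values in the model space of the Lie algebra. -/
noncomputable def adOrbit {EH : Type*} [NormedAddCommGroup EH] [NormedSpace ℝ EH]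
    {H : Type*} [TopologicalSpace H] [ChartedSpace EH H] [Group H] (v : Lie EH H) (h : H) : EH :=
  Ad h v

theorem contMDiff_conj (h : H) :
    ContMDiff 𝓘(ℝ, EH) 𝓘(ℝ, EH) ∞ (fun x : H => h * x * h⁻¹) :=
  (contMDiff_const.mul contMDiff_id).mul contMDiff_const

/-- Differentials of a smooth family of maps depend smoothly on the parameter in tangent
coordinates. Conjugations fix `1`, so both tangent spaces stay `T_1 H` and these coordinates are the
identity. -/
theorem contMDiff_adOrbit (v : Lie EH H) :
    ContMDiff 𝓘(ℝ, EH) 𝓘(ℝ, EH) ∞ (adOrbit v : H → EH) := by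
  have : IsManifold 𝓘(ℝ, EH) ∞ H := ContMDiffMul.toIsManifold
  have : IsManifold 𝓘(ℝ, EH) 1 H := IsManifold.of_le (n := ∞) (by simp)
  intro h₀
  have h1 : ContMDiff (𝓘(ℝ, EH).prod 𝓘(ℝ, EH)) 𝓘(ℝ, EH) ∞
      (Function.uncurry (fun h x : H => h * x * h⁻¹)) :=
    (contMDiff_fst.mul contMDiff_snd).mul contMDiff_fst.inv
  have h2 := ContMDiffAt.mfderiv (x₀ := h₀) (m := ∞) (fun h x : H => h * x * h⁻¹)
    (fun _ : H => (1 : H)) h1.contMDiffAt contMDiffAt_const (by simp)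
  have h3 : (fun h : H => h * 1 * h⁻¹) = fun _ => 1 := by ext; simp
  let v' : EH := v
  have h4 := h2.clm_apply (contMDiffAt_const (c := v'))
  refine h4.congr_of_eventuallyEq (Eventually.of_forall fun h => ?_)
  have h5 : ∀ (f : H → H) (ϕ : H → EH →L[ℝ] EH), f = (fun _ => 1) →
      inTangentCoordinates 𝓘(ℝ, EH) 𝓘(ℝ, EH) (fun _ : H => (1 : H)) f ϕ h₀ h = ϕ h := by
    rintro f ϕ rfl
    rw [inTangentCoordinates_eq (fun _ : H => (1 : H)) (fun _ : H => (1 : H)) ϕ (x₀ := h₀) (x := h)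
      (mem_chart_source EH (1 : H)) (mem_chart_source EH (1 : H))]
    ext w
    simp only [ContinuousLinearMap.comp_apply]
    rw [(tangentBundleCore 𝓘(ℝ, EH) H).coordChange_self _ _ (mem_chart_source EH (1 : H)),
      (tangentBundleCore 𝓘(ℝ, EH) H).coordChange_self _ _ (mem_chart_source EH (1 : H))]
  exact (congrArg (fun l : EH →L[ℝ] EH => l v')
    (h5 _ (fun h => mfderiv 𝓘(ℝ, EH) 𝓘(ℝ, EH) (fun x : H => h * x * h⁻¹) 1) h3)).symm

/-- The derivative of the adjoint action is the bracket of the Lie algebra. -/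
theorem lie_eq_neg_mfderiv_adOrbit [FiniteDimensional ℝ EH] (X Y : Lie EH H) :
    (⁅X, Y⁆ : Lie EH H) = -(mfderiv 𝓘(ℝ, EH) 𝓘(ℝ, EH) (adOrbit X : H → EH) 1 Y : EH) := by
  have : IsManifold 𝓘(ℝ, EH) ∞ H := ContMDiffMul.toIsManifold
  have : LieGroup 𝓘(ℝ, EH) (minSmoothness ℝ 3) H := by
    rw [minSmoothness_of_isRCLikeNormedField]
    exact LieGroup.of_le (n := ∞) ENat.LEInfty.out
  have : IsManifold 𝓘(ℝ, EH) 2 H :=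
    IsManifold.of_le (n := ∞) ENat.LEInfty.out
  have hact : ContMDiff (𝓘(ℝ, EH).prod 𝓘(ℝ, EH)) 𝓘(ℝ, EH) ∞
      (fun q : H × H => rt q.2 q.1) := contMDiff_mul 𝓘(ℝ, EH) ∞
  have hW : MDifferentiableAt 𝓘(ℝ, EH) 𝓘(ℝ, EH).tangent
    (fun g : H => (mulInvariantVectorField X g : TangentBundle 𝓘(ℝ, EH) H)) 1 :=
    mdifferentiableAt_mulInvariantVectorField X
  have hW' := (mdifferentiableWithinAt_univ.2
    hW).differentiableWithinAt_mpullbackWithin_vectorField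
  simp only [Set.preimage_univ, Set.univ_inter] at hW'
  -- For right translations of `H` on itself the orbit map through `h` is left multiplication by
  -- `h`, so fundamental fields are left invariant fields.
  refine mlieBracket_fundField hact 1 (mulInvariantVectorField X) ?_
    ((contMDiff_adOrbit X).mdifferentiableAt (by simp)) ?_ Y
  · have h1 : Set.range 𝓘(ℝ, EH) = Set.univ := by simp
    refine (hW'.differentiableAt ?_)
    rw [h1]; exact univ_mem
  · intro g
    -- Left multiplication by `g` is conjugation by `g` followed by right multiplication by `g`;
    -- hence `a g = Ad g X`.
    have key : ∀ y a : H, y = g * 1 * g⁻¹ → a = g →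
        (mfderiv 𝓘(ℝ, EH) 𝓘(ℝ, EH) (fun x : H => a * x) 1 X : EH) =
        (mfderiv 𝓘(ℝ, EH) 𝓘(ℝ, EH) (fun x : H => x * g) y
          (mfderiv 𝓘(ℝ, EH) 𝓘(ℝ, EH) (fun x : H => g * x * g⁻¹) 1 X : EH) : EH) := by
      rintro y a rfl rfl
      have h1 := mfderiv_comp (1 : H) (g := fun x : H => x * a) (f := fun x : H => a * x * a⁻¹)
        (I' := 𝓘(ℝ, EH)) (((contMDiff_mul_right (I := 𝓘(ℝ, EH)) (n := ∞))).mdifferentiableAt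
          (by simp)) ((contMDiff_conj a).mdifferentiableAt (by simp))
      have h2 : (fun x : H => x * a) ∘ (fun x : H => a * x * a⁻¹) = fun x => a * x := by
        ext x; simp
      rw [h2] at h1
      exact congrArg (fun l => (l X : EH)) h1
    exact key 1 (1 * g) (by simp) (by simp)

variable {EG : Type*} [NormedAddCommGroup EG] [NormedSpace ℝ EG]
  {G : Type*} [TopologicalSpace G] [ChartedSpace EG G] [Group G]

/-- Differentiate at `1` the identity between `ι` after conjugation by `g` and conjugation by `ι g`
after `ι`. -/
theorem Ad_dHom [LieGroup 𝓘(ℝ, EG) ∞ G] {ι : G →* H} (hι : ContMDiff 𝓘(ℝ, EG) 𝓘(ℝ, EH) ∞ ι) (g : G) (X : Lie EG G) :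
    Ad (ι g) (dHom EG EH ι X) = dHom EG EH ι (Ad g X) := by
  have hιd : MDifferentiable 𝓘(ℝ, EG) 𝓘(ℝ, EH) ι := hι.mdifferentiable (by simp)
  have key : ∀ (y : H) (z : G), y = ι 1 → z = g * 1 * g⁻¹ →
      (mfderiv 𝓘(ℝ, EH) 𝓘(ℝ, EH) (fun x : H => ι g * x * (ι g)⁻¹) y
        (mfderiv 𝓘(ℝ, EG) 𝓘(ℝ, EH) ι 1 X : EH) : EH) =
      (mfderiv 𝓘(ℝ, EG) 𝓘(ℝ, EH) ι z
        (mfderiv 𝓘(ℝ, EG) 𝓘(ℝ, EG) (fun x : G => g * x * g⁻¹) 1 X : EG) : EH) := by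
    rintro y z rfl rfl
    have h1 := mfderiv_comp (1 : G) (g := fun x : H => ι g * x * (ι g)⁻¹) (f := ι)
      (I' := 𝓘(ℝ, EH)) ((contMDiff_conj (ι g)).mdifferentiableAt (by simp)) (hιd 1)
    have h2 := mfderiv_comp (1 : G) (g := ι) (f := fun x : G => g * x * g⁻¹)
      (I' := 𝓘(ℝ, EG)) (hιd _) ((contMDiff_conj g).mdifferentiableAt (by simp))
    have h3 : (fun x : H => ι g * x * (ι g)⁻¹) ∘ ι = ι ∘ (fun x : G => g * x * g⁻¹) := by
      ext x; simp
    rw [h3] at h1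
    exact (congrArg (fun l => (l X : EH)) h1).symm.trans (congrArg (fun l => (l X : EH)) h2)
  exact key 1 1 (by simp) (by simp)

theorem contMDiff_adOrbit_comp {ι : G →* H} (hι : ContMDiff 𝓘(ℝ, EG) 𝓘(ℝ, EH) ∞ ι)
    (v : Lie EH H) : ContMDiff 𝓘(ℝ, EG) 𝓘(ℝ, EH) ∞ (fun g : G => adOrbit v (ι g)) :=
  (contMDiff_adOrbit v).comp hι

theorem lie_dHom_eq_neg_mfderiv_adOrbit [FiniteDimensional ℝ EH] {ι : G →* H}
    (hι : ContMDiff 𝓘(ℝ, EG) 𝓘(ℝ, EH) ∞ ι) (X : Lie EH H) (Y : Lie EG G) :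
    (⁅X, dHom EG EH ι Y⁆ : Lie EH H) =
      -(mfderiv 𝓘(ℝ, EG) 𝓘(ℝ, EH) (fun g : G => adOrbit X (ι g)) 1 Y : EH) := by
  rw [lie_eq_neg_mfderiv_adOrbit]
  have key : ∀ y : H, y = ι 1 →
      (mfderiv 𝓘(ℝ, EH) 𝓘(ℝ, EH) (adOrbit X : H → EH) y
        (mfderiv 𝓘(ℝ, EG) 𝓘(ℝ, EH) ι 1 Y : EH) : EH) =
      mfderiv 𝓘(ℝ, EG) 𝓘(ℝ, EH) (fun g : G => adOrbit X (ι g)) 1 Y := by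
    rintro y rfl
    have h1 := mfderiv_comp (1 : G) (g := (adOrbit X : H → EH)) (f := ι)
      (I' := 𝓘(ℝ, EH)) ((contMDiff_adOrbit X).mdifferentiableAt (by simp))
      (hι.mdifferentiableAt (by simp))
    exact (congrArg (fun l => (l Y : EH)) h1).symm
  exact congrArg (fun w : EH => -w) (key 1 (by simp))

end Adjoint

/-! ### Regularity of parallel fields. -/

section Parallel

variable {EP : Type*} [NormedAddCommGroup EP] [NormedSpace ℝ EP]
  {P : Type*} [TopologicalSpace P] [ChartedSpace EP P]
  {K : Type*} [NormedAddCommGroup K] [NormedSpace ℝ K] [FiniteDimensional ℝ K]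

theorem contDiffOn_of_forall_dual {E : Type*} [NormedAddCommGroup E] [NormedSpace ℝ E]
    {f : E → K} {s : Set E} {n : WithTop ℕ∞}
    (h : ∀ ℓ : Module.Dual ℝ K, ContDiffOn ℝ n (fun x => ℓ (f x)) s) : ContDiffOn ℝ n f s := by
  let e := (Module.finBasis ℝ K).equivFunL
  rw [← e.comp_contDiffOn_iff, contDiffOn_pi]
  intro i
  exact h ((LinearMap.proj i) ∘ₗ e.toLinearEquiv.toLinearMap)

/-- A form read in the chart at `u₀`. -/
noncomputable def chartForm [FiniteDimensional ℝ EP] (κ : Form EP P K) (u₀ : P) (x : EP) :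
    EP →L[ℝ] K :=
  LinearMap.toContinuousLinearMap ((κ ((extChartAt 𝓘(ℝ, EP) u₀).symm x)) ∘ₗ
    (mfderivWithin 𝓘(ℝ, EP) 𝓘(ℝ, EP) (extChartAt 𝓘(ℝ, EP) u₀).symm
      (Set.range 𝓘(ℝ, EP)) x).toLinearMap)

variable [IsManifold 𝓘(ℝ, EP) ∞ P] [FiniteDimensional ℝ EP]

/-- On a fixed vector `v`, the chart form is `κ` along the tangent map of the inverse chart applied
to the constant field `v`. In finite dimension, smoothness on each vector gives smoothness as an
operator. -/
theorem contDiffOn_chartForm {κ : Form EP P K} (hκ : IsSmoothForm κ) (u₀ : P) :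
    ContDiffOn ℝ ∞ (chartForm κ u₀) (extChartAt 𝓘(ℝ, EP) u₀).target := by
  set φ := extChartAt 𝓘(ℝ, EP) u₀ with hφ
  have hopen : IsOpen φ.target := isOpen_extChartAt_target u₀
  have hrange : Set.range 𝓘(ℝ, EP) = Set.univ := by simp
  rw [contDiffOn_clm_apply]
  intro v
  refine contDiffOn_of_forall_dual fun ℓ => ?_
  have h1 : ContMDiffOn 𝓘(ℝ, EP).tangent 𝓘(ℝ, EP).tangent ∞
      (tangentMapWithin 𝓘(ℝ, EP) 𝓘(ℝ, EP) φ.symm φ.target)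
      (Bundle.TotalSpace.proj ⁻¹' φ.target) :=
    (contMDiffOn_extChartAt_symm (n := ∞) u₀).contMDiffOn_tangentMapWithin (by simp)
      hopen.uniqueMDiffOn
  have h2 : ContMDiff 𝓘(ℝ, EP) 𝓘(ℝ, EP).tangent ∞
      (fun x : EP => (⟨x, v⟩ : TangentBundle 𝓘(ℝ, EP) EP)) := by
    intro x
    rw [Bundle.contMDiffAt_totalSpace]
    refine ⟨contMDiffAt_id, ?_⟩
    simp only [trivializationAt_model_space_apply]
    exact contMDiffAt_const
  have h3 : ContMDiffOn 𝓘(ℝ, EP) 𝓘(ℝ) ∞ (fun x => ℓ (chartForm κ u₀ x v)) φ.target := by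
    refine ((hκ ℓ).comp_contMDiffOn (h1.comp h2.contMDiffOn (fun x hx => hx))).congr ?_
    intro x hx
    have h4 : mfderivWithin 𝓘(ℝ, EP) 𝓘(ℝ, EP) φ.symm φ.target x =
        mfderivWithin 𝓘(ℝ, EP) 𝓘(ℝ, EP) φ.symm (Set.range 𝓘(ℝ, EP)) x := by
      rw [hrange, mfderivWithin_univ, mfderivWithin_of_isOpen hopen hx]
    simp only [chartForm, Function.comp_apply, tangentMapWithin, h4]
    rfl
  exact h3.contDiffOn

/-- In the chart the field is `x ↦ (chartForm κ u₀ x)⁻¹ X`, and operator inversion is smooth at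
invertible operators. -/
theorem differentiableAt_chart_parallelField {κ : Form EP P K} (hκ : IsSmoothForm κ)
    (hb : ∀ u, Function.Bijective (κ u)) (X : K) (u₀ : P) :
    DifferentiableAt ℝ (VectorField.mpullbackWithin 𝓘(ℝ, EP) 𝓘(ℝ, EP)
      (extChartAt 𝓘(ℝ, EP) u₀).symm (parallelField κ hb X) (Set.range 𝓘(ℝ, EP)))
      (extChartAt 𝓘(ℝ, EP) u₀ u₀) := by
  have : IsManifold 𝓘(ℝ, EP) 1 P := IsManifold.of_le (n := ∞) (by simp)
  have hinv : ∀ x ∈ (extChartAt 𝓘(ℝ, EP) u₀).target, (chartForm κ u₀ x).IsInvertible := by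
    intro x hx
    obtain ⟨e, he⟩ := isInvertible_mfderivWithin_extChartAt_symm (I := 𝓘(ℝ, EP)) hx
    have hbij : Function.Bijective (chartForm κ u₀ x) := by
      have : Function.Bijective ((κ ((extChartAt 𝓘(ℝ, EP) u₀).symm x)) ∘ e) :=
        (hb _).comp e.bijective
      have h2 : ((κ ((extChartAt 𝓘(ℝ, EP) u₀).symm x)) ∘ e : EP → K) = chartForm κ u₀ x := by
        funext v
        exact congrArg (fun l => κ ((extChartAt 𝓘(ℝ, EP) u₀).symm x) (l v)) he
      exact h2 ▸ this
    exact ⟨(LinearEquiv.ofBijective (chartForm κ u₀ x).toLinearMap hbij).toContinuousLinearEquiv,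
      by ext; rfl⟩
  have hmem := extChartAt_target_mem_nhds (I := 𝓘(ℝ, EP)) u₀
  have h1 : DifferentiableAt ℝ (fun x => (chartForm κ u₀ x).inverse X)
      (extChartAt 𝓘(ℝ, EP) u₀ u₀) := by
    have h2 := ((hinv _ (mem_extChartAt_target u₀)).contDiffAt_map_inverse (n := ∞)).comp _
      ((contDiffOn_chartForm hκ u₀).contDiffAt hmem)
    exact (h2.differentiableAt (by simp)).clm_apply (differentiableAt_const X)
  refine h1.congr_of_eventuallyEq ?_
  filter_upwards [hmem] with x hx
  obtain ⟨e, he⟩ := isInvertible_mfderivWithin_extChartAt_symm (I := 𝓘(ℝ, EP)) hx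
  obtain ⟨e', he'⟩ := hinv x hx
  rw [← he', VectorField.mpullbackWithin_apply, ← he]
  simp only [ContinuousLinearMap.inverse_equiv]
  refine (e'.symm_apply_eq.2 ?_).symm
  have h3 : ∀ w : EP, e' w = κ ((extChartAt 𝓘(ℝ, EP) u₀).symm x) (e w) := by
    intro w
    refine (congrArg (fun l => l w) he').trans ?_
    exact (congrArg (fun l => κ ((extChartAt 𝓘(ℝ, EP) u₀).symm x) (l w)) he).symm
  refine Eq.trans ?_ (h3 _).symm
  refine Eq.trans ?_ (congrArg (κ ((extChartAt 𝓘(ℝ, EP) u₀).symm x))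
    (e.apply_symm_apply (parallelField κ hb X _))).symm
  exact ((LinearEquiv.ofBijective _ (hb _)).apply_symm_apply X).symm

end Parallel

/-! ### Vertical vectors and dimensions of a principal bundle. -/

section Bundle

variable {EG : Type*} [NormedAddCommGroup EG] [NormedSpace ℝ EG]
  {G : Type*} [TopologicalSpace G] [ChartedSpace EG G] [Group G]
  {EP : Type*} [NormedAddCommGroup EP] [NormedSpace ℝ EP]
  {P : Type*} [TopologicalSpace P] [ChartedSpace EP P] [MulAction Gᵐᵒᵖ P]
  {EM : Type*} [NormedAddCommGroup EM] [NormedSpace ℝ EM]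
  {M : Type*} [TopologicalSpace M] [ChartedSpace EM M]

theorem IsPrincipalBundle.surjective {p : P → M} (hp : IsPrincipalBundle EG G EP EM p) :
    Function.Surjective p := by
  intro x
  obtain ⟨e, hxe, -⟩ := hp.exists_trivialization x
  exact ⟨e.toOpenPartialHomeomorph.symm (x, 1), e.proj_symm_apply' hxe⟩

variable [LieGroup 𝓘(ℝ, EG) ∞ G]

theorem mfderiv_mul_left_surjective (g : G) (Y : EG) :
    ∃ X : Lie EG G, (mfderiv 𝓘(ℝ, EG) 𝓘(ℝ, EG) (fun h : G => g * h) 1 X : EG) = Y := by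
  have hd : ∀ a x : G, MDifferentiableAt 𝓘(ℝ, EG) 𝓘(ℝ, EG) (fun h : G => a * h) x := fun a x =>
    (contMDiff_mul_left (I := 𝓘(ℝ, EG)) (n := ∞)).mdifferentiableAt (by simp)
  have key : ∀ y : G, y = g⁻¹ * g → (mfderiv 𝓘(ℝ, EG) 𝓘(ℝ, EG) (fun h : G => g * h) y
      (mfderiv 𝓘(ℝ, EG) 𝓘(ℝ, EG) (fun h : G => g⁻¹ * h) g Y : EG) : EG) = Y := by
    rintro y rfl
    have h1 := mfderiv_comp g (g := fun h : G => g * h) (f := fun h : G => g⁻¹ * h)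
      (I' := 𝓘(ℝ, EG)) (hd _ _) (hd _ _)
    have h2 : (fun h : G => g * h) ∘ (fun h : G => g⁻¹ * h) = id := by ext; simp
    rw [h2, mfderiv_id] at h1
    exact (congrArg (fun l => (l Y : EG)) h1).symm
  exact ⟨_, key 1 (by simp)⟩

/-- `A` is the differential of an equivariant trivialization at `u`, and `g` is the fibre coordinate
of `u`. It gives both the description of vertical vectors and the dimension count. -/
theorem IsPrincipalBundle.exists_equiv {p : P → M} (hp : IsPrincipalBundle EG G EP EM p) (u : P) :
    ∃ A : EP ≃L[ℝ] EM × EG,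
      (∀ ξ : EP, (mfderiv 𝓘(ℝ, EP) 𝓘(ℝ, EM) p u ξ : EM) = (A ξ).1) ∧
      ∃ g : G, ∀ X : Lie EG G, A (fundField X u : EP) =
        (0, (mfderiv 𝓘(ℝ, EG) 𝓘(ℝ, EG) (fun h : G => g * h) 1 X : EG)) := by
  obtain ⟨e, hxe, he, hes, heq⟩ := hp.exists_trivialization (p u)
  have hu : u ∈ e.source := e.mem_source.2 hxe
  have hmd : e.toOpenPartialHomeomorph.MDifferentiable 𝓘(ℝ, EP) (𝓘(ℝ, EM).prod 𝓘(ℝ, EG)) :=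
    ⟨he.mdifferentiableOn (by simp), hes.mdifferentiableOn (by simp)⟩
  let A : EP ≃L[ℝ] EM × EG := hmd.mfderiv hu
  have hA : ∀ ξ : EP, A ξ =
      (mfderiv 𝓘(ℝ, EP) (𝓘(ℝ, EM).prod 𝓘(ℝ, EG)) e u ξ : EM × EG) := fun ξ => rfl
  have hed : MDifferentiableAt 𝓘(ℝ, EP) (𝓘(ℝ, EM).prod 𝓘(ℝ, EG)) e u :=
    (he.contMDiffAt (e.open_source.mem_nhds hu)).mdifferentiableAt (by simp)
  refine ⟨A, fun ξ => ?_, (e u).2, fun X => ?_⟩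
  · have h1 := mfderiv_comp u (g := Prod.fst) (f := e) (I' := 𝓘(ℝ, EM).prod 𝓘(ℝ, EG))
      (I'' := 𝓘(ℝ, EM)) mdifferentiableAt_fst hed
    have h2 : Prod.fst ∘ e =ᶠ[𝓝 u] p := by
      filter_upwards [e.open_source.mem_nhds hu] with v hv
      exact e.coe_fst hv
    rw [h2.mfderiv_eq, mfderiv_fst] at h1
    exact congrArg (fun l => (l ξ : EM)) h1
  · refine (hA _).trans ?_
    have hr : MDifferentiableAt 𝓘(ℝ, EG) 𝓘(ℝ, EP) (fun g : G => rt g u) 1 :=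
      (contMDiff_rt_right hp.contMDiff_action u).mdifferentiableAt (by simp)
    have hm : MDifferentiableAt 𝓘(ℝ, EG) 𝓘(ℝ, EG) (fun h : G => (e u).2 * h) 1 :=
      (contMDiff_mul_left (I := 𝓘(ℝ, EG)) (n := ∞)).mdifferentiableAt (by simp)
    have h3 : e ∘ (fun g : G => rt g u) = fun g : G => ((e u).1, (e u).2 * g) := by
      ext1 g
      exact heq u hu g
    have key : ∀ y : P, y = rt (1 : G) u →
        (mfderiv 𝓘(ℝ, EP) (𝓘(ℝ, EM).prod 𝓘(ℝ, EG)) e y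
          (mfderiv 𝓘(ℝ, EG) 𝓘(ℝ, EP) (fun g : G => rt g u) 1 X : EP) : EM × EG) =
        mfderiv 𝓘(ℝ, EG) (𝓘(ℝ, EM).prod 𝓘(ℝ, EG)) (fun g : G => ((e u).1, (e u).2 * g)) 1 X := by
      rintro y rfl
      have h1 := mfderiv_comp (1 : G) (g := e) (f := fun g : G => rt g u) (I' := 𝓘(ℝ, EP))
        (I'' := 𝓘(ℝ, EM).prod 𝓘(ℝ, EG)) (by rwa [rt_one]) hr
      rw [h3] at h1
      exact (congrArg (fun l => (l X : EM × EG)) h1).symm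
    refine (key u (rt_one u).symm).trans ?_
    have h4 := mfderiv_prodMk (x := (1 : G)) (mdifferentiableAt_const (c := (e u).1)
      (I := 𝓘(ℝ, EG)) (I' := 𝓘(ℝ, EM))) hm
    rw [mfderiv_const] at h4
    exact congrArg (fun l => (l X : EM × EG)) h4

theorem IsPrincipalBundle.mem_vertical_iff {p : P → M} (hp : IsPrincipalBundle EG G EP EM p)
    (u : P) (ξ : TangentSpace 𝓘(ℝ, EP) u) :
    ξ ∈ vertical EP EM p u ↔ ∃ X : Lie EG G, fundField X u = ξ := by
  obtain ⟨A, hA, g, hg⟩ := hp.exists_equiv u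
  have h0 : ξ ∈ vertical EP EM p u ↔ (A ξ).1 = 0 := by
    rw [← hA ξ]; exact LinearMap.mem_ker
  rw [h0]
  constructor
  · intro h
    obtain ⟨X, hX⟩ := mfderiv_mul_left_surjective g (A ξ).2
    refine ⟨X, A.injective ?_⟩
    rw [hg]
    exact Prod.ext h.symm hX
  · rintro ⟨X, rfl⟩
    rw [hg]

theorem IsPrincipalBundle.finrank_eq [FiniteDimensional ℝ EG] [FiniteDimensional ℝ EM]
    {p : P → M} (hp : IsPrincipalBundle EG G EP EM p) (u : P) :
    Module.finrank ℝ EP = Module.finrank ℝ EM + Module.finrank ℝ EG := by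
  obtain ⟨A, -⟩ := hp.exists_equiv u
  rw [A.toLinearEquiv.finrank_eq, Module.finrank_prod]

end Bundle

/-! ### Linear algebra of the reductive decomposition. -/

section Decomposition

variable {EG : Type*} [NormedAddCommGroup EG] [NormedSpace ℝ EG]
  {G : Type*} [TopologicalSpace G] [ChartedSpace EG G] [Group G]
  {EH : Type*} [NormedAddCommGroup EH] [NormedSpace ℝ EH]
  {H : Type*} [TopologicalSpace H] [ChartedSpace EH H] [Group H]
  {ι : G →* H} {V : Submodule ℝ (Lie EH H)}

theorem prV_apply_add (hV : IsReductive EG ι V) (v : V) (X : Lie EG G) :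
    prV hV ((v : Lie EH H) + dHom EG EH ι X) = v := by
  have hX : dHom EG EH ι X ∈ subAlg EG EH ι := ⟨X, rfl⟩
  rw [map_add, prV, Submodule.projectionOnto_apply_left,
    Submodule.projectionOnto_apply_of_mem_right _ hX, add_zero]

theorem prG_apply_add (hι : IsLieSubgroup EG EH ι) (hV : IsReductive EG ι V) (v : V)
    (X : Lie EG G) : prG hι hV ((v : Lie EH H) + dHom EG EH ι X) = X := by
  have h : (subAlg EG EH ι).projectionOnto V hV.isCompl.symm ((v : Lie EH H) + dHom EG EH ι X) =
      LinearEquiv.ofInjective (dHom EG EH ι) hι.injective_dHom X := by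
    rw [map_add, Submodule.projectionOnto_apply_of_mem_right _ v.2, zero_add]
    exact Submodule.projectionOnto_apply_left _
      (LinearEquiv.ofInjective (dHom EG EH ι) hι.injective_dHom X)
  exact (LinearEquiv.symm_apply_eq _).2 h

theorem exists_add_dHom (hV : IsReductive EG ι V) (w : Lie EH H) :
    ∃ (v : V) (X : Lie EG G), w = (v : Lie EH H) + dHom EG EH ι X := by
  have hw : w ∈ V ⊔ subAlg EG EH ι := by rw [hV.isCompl.sup_eq_top]; trivial
  obtain ⟨v, hv, _, ⟨X, rfl⟩, rfl⟩ := Submodule.mem_sup.1 hw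
  exact ⟨⟨v, hv⟩, X, rfl⟩

theorem prV_eq_zero_iff (hV : IsReductive EG ι V) (w : Lie EH H) :
    prV hV w = 0 ↔ ∃ X : Lie EG G, w = dHom EG EH ι X := by
  obtain ⟨v, X, rfl⟩ := exists_add_dHom hV w
  rw [prV_apply_add]
  constructor
  · rintro rfl
    exact ⟨X, by simp⟩
  · rintro ⟨Y, hY⟩
    have := prV_apply_add hV v X
    rw [hY] at this
    have h0 := prV_apply_add hV 0 Y
    rw [Submodule.coe_zero, zero_add] at h0
    exact this.symm.trans h0

theorem finrank_lie_eq [FiniteDimensional ℝ EH] (hι : IsLieSubgroup EG EH ι)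
    (hV : IsReductive EG ι V) :
    Module.finrank ℝ EH = Module.finrank ℝ V + Module.finrank ℝ EG := by
  have : FiniteDimensional ℝ (Lie EH H) := inferInstanceAs (FiniteDimensional ℝ EH)
  have h1 := Submodule.finrank_add_eq_of_isCompl hV.isCompl
  have h2 : Module.finrank ℝ (subAlg EG EH ι) = Module.finrank ℝ (Lie EG G) :=
    LinearMap.finrank_range_of_inj hι.injective_dHom
  rw [h2] at h1
  exact h1.symm

variable [LieGroup 𝓘(ℝ, EH) ∞ H]

theorem contMDiff_adRep [FiniteDimensional ℝ EH] (hι : IsLieSubgroup EG EH ι)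
    (hV : IsReductive EG ι V) (v : V) (ℓ : Module.Dual ℝ V) :
    ContMDiff 𝓘(ℝ, EG) 𝓘(ℝ) ∞ (fun g : G => ℓ (adRep hV g v)) := by
  -- Extending `ℓ` by zero on `𝔤` makes the matrix coefficient a linear function of the smooth orbit
  -- map in `𝔥`.
  let L : EH →ₗ[ℝ] ℝ := ℓ ∘ₗ prV hV
  have h := (LinearMap.toContinuousLinearMap L).contMDiff.comp
    (contMDiff_adOrbit_comp hι.contMDiff (v : Lie EH H))
  refine h.congr fun g => ?_
  have h1 : prV hV (Ad (ι g) (v : Lie EH H)) = adRep hV g v := by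
    have := prV_apply_add hV (adRep hV g v) 0
    rwa [map_zero, add_zero] at this
  exact congrArg ℓ h1.symm

variable [LieGroup 𝓘(ℝ, EG) ∞ G]

theorem Ad_add_dHom (hι : IsLieSubgroup EG EH ι) (hV : IsReductive EG ι V) (g : G) (v : V)
    (X : Lie EG G) : Ad (ι g) ((v : Lie EH H) + dHom EG EH ι X) =
      (adRep hV g v : Lie EH H) + dHom EG EH ι (Ad g X) := by
  rw [map_add, Ad_dHom hι.contMDiff]
  rfl

theorem prV_Ad (hι : IsLieSubgroup EG EH ι) (hV : IsReductive EG ι V) (g : G) (w : Lie EH H) :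
    prV hV (Ad (ι g) w) = adRep hV g (prV hV w) := by
  obtain ⟨v, X, rfl⟩ := exists_add_dHom hV w
  rw [Ad_add_dHom hι, prV_apply_add, prV_apply_add]

theorem prG_Ad (hι : IsLieSubgroup EG EH ι) (hV : IsReductive EG ι V) (g : G) (w : Lie EH H) :
    prG hι hV (Ad (ι g) w) = Ad g (prG hι hV w) := by
  obtain ⟨v, X, rfl⟩ := exists_add_dHom hV w
  rw [Ad_add_dHom hι hV, prG_apply_add, prG_apply_add]

end Decomposition

/-! ### The bracket condition from equivariance. -/

section Cartan

variable {EG : Type*} [NormedAddCommGroup EG] [NormedSpace ℝ EG]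
  {G : Type*} [TopologicalSpace G] [ChartedSpace EG G] [Group G] [LieGroup 𝓘(ℝ, EG) ∞ G]
  {EH : Type*} [NormedAddCommGroup EH] [NormedSpace ℝ EH] [FiniteDimensional ℝ EH]
  {H : Type*} [TopologicalSpace H] [ChartedSpace EH H] [Group H] [LieGroup 𝓘(ℝ, EH) ∞ H]
  {EP : Type*} [NormedAddCommGroup EP] [NormedSpace ℝ EP] [FiniteDimensional ℝ EP]
  {P : Type*} [TopologicalSpace P] [ChartedSpace EP P] [IsManifold 𝓘(ℝ, EP) ∞ P]
  [MulAction Gᵐᵒᵖ P]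

/-- An equivariant absolute parallelism that extends the vertical one is compatible with the
brackets with elements of the Lie algebra of the structure group. -/
theorem mlieBracket_parallelField {ι : G →* H} (hι : ContMDiff 𝓘(ℝ, EG) 𝓘(ℝ, EH) ∞ ι)
    (hact : ContMDiff (𝓘(ℝ, EP).prod 𝓘(ℝ, EG)) 𝓘(ℝ, EP) ∞ (fun q : P × G => rt q.2 q.1))
    {κ : Form EP P (Lie EH H)} (hκ : IsSmoothForm κ) (hb : ∀ u, Function.Bijective (κ u))
    (hvert : ∀ (u : P) (X : Lie EG G), κ u (fundField X u) = dHom EG EH ι X)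
    (hequi : ∀ (g : G) (u : P) (ξ : TangentSpace 𝓘(ℝ, EP) u),
      κ (rt g u) (tangentRt g u ξ) = Ad (ι g⁻¹) (κ u ξ))
    (X : Lie EH H) (Y : Lie EG G) (u : P) :
    VectorField.mlieBracket 𝓘(ℝ, EP) (parallelField κ hb X)
      (parallelField κ hb (dHom EG EH ι Y)) u = parallelField κ hb ⁅X, dHom EG EH ι Y⁆ u := by
  have : IsManifold 𝓘(ℝ, EG) ∞ G := ContMDiffMul.toIsManifold
  have hpar : ∀ (u : P) (ξ : TangentSpace 𝓘(ℝ, EP) u) (w : Lie EH H), κ u ξ = w →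
      parallelField κ hb w u = ξ := by
    rintro u ξ w rfl
    exact (LinearEquiv.ofBijective (κ u) (hb u)).symm_apply_apply ξ
  have hκpar : ∀ (u : P) (w : Lie EH H), κ u (parallelField κ hb w u) = w := fun u w =>
    (LinearEquiv.ofBijective (κ u) (hb u)).apply_symm_apply w
  have hfund : parallelField κ hb (dHom EG EH ι Y) = fundField Y :=
    funext fun u => hpar u _ _ (hvert u Y)
  let L : EH →ₗ[ℝ] EP := (LinearEquiv.ofBijective (κ u) (hb u)).symm.toLinearMap
  let L' : EH →L[ℝ] EP := LinearMap.toContinuousLinearMap L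
  have ha : MDifferentiableAt 𝓘(ℝ, EG) 𝓘(ℝ, EH) (fun g : G => adOrbit X (ι g)) 1 :=
    (contMDiff_adOrbit_comp hι X).mdifferentiableAt (by simp)
  have hLa : MDifferentiableAt 𝓘(ℝ, EG) 𝓘(ℝ, EP) (fun g : G => L' (adOrbit X (ι g))) 1 :=
    L'.mdifferentiableAt.comp 1 ha
  have hder : (mfderiv 𝓘(ℝ, EG) 𝓘(ℝ, EP) (fun g : G => L' (adOrbit X (ι g))) 1 Y : EP) =
      L' (mfderiv 𝓘(ℝ, EG) 𝓘(ℝ, EH) (fun g : G => adOrbit X (ι g)) 1 Y : EH) := by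
    have := mfderiv_comp 1 (g := L') (I' := 𝓘(ℝ, EH)) L'.mdifferentiableAt ha
    rw [mfderiv_eq_fderiv, ContinuousLinearMap.fderiv] at this
    exact congrArg (fun l => (l Y : EP)) this
  -- Here `a g = κ_u⁻¹ (Ad (ι g) X)`: equivariance applies `Ad (ι g⁻¹)`, which cancels `Ad (ι g)`
  -- and leaves the constant value `X` of `κ` on the field.
  have hmain := mlieBracket_fundField hact u (parallelField κ hb X)
    (differentiableAt_chart_parallelField (K := EH) hκ hb X u) hLa (fun g => by
      refine hpar _ _ _ ?_
      refine (hequi g u _).trans ?_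
      refine (congrArg (Ad (ι g⁻¹)) (hκpar u (Ad (ι g) X))).trans ?_
      rw [← Ad_mul_apply, ← map_mul, inv_mul_cancel, map_one, Ad_one_apply]) Y
  rw [hfund, hmain, lie_dHom_eq_neg_mfderiv_adOrbit hι]
  exact (congrArg Neg.neg hder).trans (map_neg L' _).symm

end Cartan

end CartanConn

/-! ### Assembly of the two directions. -/

open CartanConn in
theorem proposition2p4
    {EG : Type*} [NormedAddCommGroup EG] [NormedSpace ℝ EG] [FiniteDimensional ℝ EG]
    {G : Type*} [TopologicalSpace G] [ChartedSpace EG G] [Group G] [LieGroup 𝓘(ℝ, EG) ∞ G]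
    {EH : Type*} [NormedAddCommGroup EH] [NormedSpace ℝ EH] [FiniteDimensional ℝ EH]
    {H : Type*} [TopologicalSpace H] [ChartedSpace EH H] [Group H] [LieGroup 𝓘(ℝ, EH) ∞ H]
    {EM : Type*} [NormedAddCommGroup EM] [NormedSpace ℝ EM] [FiniteDimensional ℝ EM]
    {M : Type*} [TopologicalSpace M] [ChartedSpace EM M] [IsManifold 𝓘(ℝ, EM) ∞ M]
    {EP : Type*} [NormedAddCommGroup EP] [NormedSpace ℝ EP] [FiniteDimensional ℝ EP]
    {P : Type*} [TopologicalSpace P] [ChartedSpace EP P] [IsManifold 𝓘(ℝ, EP) ∞ P]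
    [MulAction Gᵐᵒᵖ P]
    (p : P → M) (hp : IsPrincipalBundle EG G EP EM p)
    (ι : G →* H) (hι : IsLieSubgroup EG EH ι)
    (V : Submodule ℝ (Lie EH H)) (hV : IsReductive EG ι V)
    (hfaithful : Function.Injective (adRep hV)) :
    (∀ κ : Form EP P (Lie EH H), IsPrincipalCartanConnection EG ι κ →
      IsGStructure EG EM (adRep hV) p (fun u => prV hV ∘ₗ κ u) ∧
      IsConnectionForm (fun u => prG hι hV ∘ₗ κ u)) ∧
    (∀ (θ : Form EP P V) (om : Form EP P (Lie EG G)),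
      IsGStructure EG EM (adRep hV) p θ → IsConnectionForm om →
      IsPrincipalCartanConnection EG ι
        (fun u => V.subtype ∘ₗ θ u + dHom EG EH ι ∘ₗ om u)) := by
  have hdE : ∀ u : P, Module.finrank ℝ EP = Module.finrank ℝ EM + Module.finrank ℝ EG :=
    hp.finrank_eq
  have hdH := finrank_lie_eq hι hV
  refine ⟨fun κ hκ => ?_, fun θ om hθ hom => ?_⟩
  · refine ⟨⟨hfaithful, contMDiff_adRep hι hV, hp, fun x => ?_, ?_, ?_, ?_⟩, ?_, ?_, ?_⟩
    · obtain ⟨u, -⟩ := hp.surjective x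
      have h1 : Module.finrank ℝ EP = Module.finrank ℝ EH :=
        (LinearEquiv.ofBijective (κ u) (hκ.bijective u)).finrank_eq
      have h2 := hdE u
      change Module.finrank ℝ EM = Module.finrank ℝ V
      omega
    · exact fun ℓ => hκ.smooth (ℓ ∘ₗ prV hV)
    · intro g u ξ
      rw [LinearMap.comp_apply, hκ.equivariant, prV_Ad hι hV]
      rfl
    · intro u
      ext ξ
      rw [hp.mem_vertical_iff, LinearMap.mem_ker, LinearMap.comp_apply, prV_eq_zero_iff]
      -- Since `κ u` is injective and sends `ζ_X(u)` to `X`, having value `X` under `κ u` means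
      -- being `ζ_X(u)`.
      refine exists_congr fun X => ?_
      rw [← hκ.vertical_eq u X]
      exact ⟨fun h => ((hκ.bijective u).1 h).symm, fun h => congrArg (κ u) h.symm⟩
    · exact fun ℓ => hκ.smooth (ℓ ∘ₗ prG hι hV)
    · intro u X
      rw [LinearMap.comp_apply, hκ.vertical_eq]
      simpa using prG_apply_add hι hV 0 X
    · intro g u ξ
      rw [LinearMap.comp_apply, hκ.equivariant, prG_Ad hι hV]
      rfl
  · have hθv : ∀ (u : P) (X : Lie EG G), θ u (fundField X u) = 0 := fun u X => by
      rw [← LinearMap.mem_ker, hθ.displacement.ker_eq, hp.mem_vertical_iff]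
      exact ⟨X, rfl⟩
    have hsmooth : IsSmoothForm (fun u => V.subtype ∘ₗ θ u + dHom EG EH ι ∘ₗ om u) := fun ℓ => by
      have h := (hθ.displacement.smooth (ℓ ∘ₗ V.subtype)).add
        (hom.smooth (ℓ ∘ₗ dHom EG EH ι))
      refine h.congr fun ξ => ?_
      exact map_add ℓ _ _
    have hbij : ∀ u, Function.Bijective (V.subtype ∘ₗ θ u + dHom EG EH ι ∘ₗ om u) := fun u => by
      -- If both components vanish on `ξ`, then `θ u ξ = 0` makes `ξ` some `ζ_X(u)`, and `ω` returns
      -- `X = 0`.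
      have hinj : Function.Injective (V.subtype ∘ₗ θ u + dHom EG EH ι ∘ₗ om u) := by
        rw [← LinearMap.ker_eq_bot, LinearMap.ker_eq_bot']
        intro ξ hξ
        have h0 : (θ u ξ : Lie EH H) + dHom EG EH ι (om u ξ) = 0 := hξ
        have h1 : θ u ξ = 0 := by rw [← prV_apply_add hV (θ u ξ) (om u ξ), h0, map_zero]
        have h2 : om u ξ = 0 := by rw [← prG_apply_add hι hV (θ u ξ) (om u ξ), h0, map_zero]
        rw [← LinearMap.mem_ker, hθ.displacement.ker_eq, hp.mem_vertical_iff] at h1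
        obtain ⟨X, rfl⟩ := h1
        rw [hom.vertical_eq] at h2
        rw [h2]
        exact map_zero (mfderiv 𝓘(ℝ, EG) 𝓘(ℝ, EP) (fun g : G => rt g u) 1)
      have : FiniteDimensional ℝ (Lie EH H) := inferInstanceAs (FiniteDimensional ℝ EH)
      have : FiniteDimensional ℝ (TangentSpace 𝓘(ℝ, EP) u) :=
        inferInstanceAs (FiniteDimensional ℝ EP)
      -- The condition `dim M = dim V` of a `G`-structure enters here, turning injectivity into
      -- bijectivity.
      have hdim : Module.finrank ℝ (TangentSpace 𝓘(ℝ, EP) u) = Module.finrank ℝ (Lie EH H) := by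
        have h1 := hdE u
        have h2 : Module.finrank ℝ EM = Module.finrank ℝ V := hθ.dim_eq (p u)
        change Module.finrank ℝ EP = Module.finrank ℝ EH
        omega
      exact ⟨hinj, (LinearMap.injective_iff_surjective_of_finrank_eq_finrank hdim).1 hinj⟩
    have hvert : ∀ (u : P) (X : Lie EG G),
        (V.subtype ∘ₗ θ u + dHom EG EH ι ∘ₗ om u) (fundField X u) = dHom EG EH ι X :=
      fun u X => by
        simp only [LinearMap.add_apply, LinearMap.comp_apply, hθv, hom.vertical_eq, map_zero,
          zero_add]
    have hequi : ∀ (g : G) (u : P) (ξ : TangentSpace 𝓘(ℝ, EP) u),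
        (V.subtype ∘ₗ θ (rt g u) + dHom EG EH ι ∘ₗ om (rt g u)) (tangentRt g u ξ) =
          Ad (ι g⁻¹) ((V.subtype ∘ₗ θ u + dHom EG EH ι ∘ₗ om u) ξ) := fun g u ξ => by
      simp only [LinearMap.add_apply, LinearMap.comp_apply, hθ.displacement.equivariant,
        hom.equivariant]
      exact (Ad_add_dHom hι hV g⁻¹ (θ u ξ) (om u ξ)).symm
    refine ⟨⟨hsmooth, hbij, ?_⟩, hvert, hequi⟩
    rintro X _ ⟨Y, rfl⟩ u
    exact mlieBracket_parallelField hι.contMDiff hp.contMDiff_action hsmooth hbij hvert hequi X Y u
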